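/- Let $d\ge 1$ and let $M(d)$ be the space of $d\times d$ complex matrices. For $A\in M(d)$ let $\rho(A)$ be the spectral radius of $A$, i.e. the maximum absolute value of an eigenvalue of $A$. Fix any norm $\|\cdot\|$ on $\mathbb{C}^d$ and give $M(d)$ the operator norm $\|A\|=\sup\{\|Av\| : \|v\|=1\}$. For a non-empty bounded set $\Sigma\subset M(d)$ put $$\|\Sigma\|=\sup_{A\in\Sigma}\|A\|,\qquad \rho(\Sigma)=\sup_{A\in\Sigma}\rho(A),$$ and for $n\ge 1$ let $\Sigma^n$ be the set of all products $A_1\cdots A_n$ with $A_1,\dots,A_n\in\Sigma$. **Theorem (Berger–Wang).** For every non-empty bounded set $\Sigma\subset M(d)$ the limit $$\mathcal{R}(\Sigma)=\lim_{n\to\infty}\|\Sigma^n\|^{1/n}$$ (the joint spectral radius of $\Sigma$) exists and is finite, and $$\mathcal{R}(\Sigma)=\limsup_{n\to\infty}\rho(\Sigma^n)^{1/n}.$$ -/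

import Mathlib

open Filter Topology
open scoped ENNReal Pointwise Matrix

noncomputable section

/-- The operator norm `‖A‖ = sup {‖A v‖ ; ‖v‖ = 1}` of a `d × d` complex matrix with respect to
a norm `N` on `ℂ^d`. It is a supremum in `[0, ∞]`, so that no value is assigned by default. -/
def matrixOpNorm {d : ℕ} (N : Seminorm ℂ (Fin d → ℂ)) (A : Matrix (Fin d) (Fin d) ℂ) : ℝ≥0∞ :=
  ⨆ (v : Fin d → ℂ) (_ : N v = 1), ENNReal.ofReal (N (A *ᵥ v))

/-- `‖Σ‖ = sup_{A ∈ Σ} ‖A‖`. -/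
def setNorm {d : ℕ} (N : Seminorm ℂ (Fin d → ℂ)) (S : Set (Matrix (Fin d) (Fin d) ℂ)) : ℝ≥0∞ :=
  ⨆ A ∈ S, matrixOpNorm N A

/-- `ρ(Σ) = sup_{A ∈ Σ} ρ(A)`. -/
def setSpectralRadius {d : ℕ} (S : Set (Matrix (Fin d) (Fin d) ℂ)) : ℝ≥0∞ :=
  ⨆ A ∈ S, spectralRadius ℂ A

/-- The joint spectral radius `R(Σ) = lim_{n → ∞} ‖Σ^n‖^{1/n}`, where `Σ^n` is the set of all
products `A₁ ⋯ Aₙ` with `Aᵢ ∈ Σ`, computed with the norm `N`. -/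
def jointSpectralRadius {d : ℕ} (N : Seminorm ℂ (Fin d → ℂ))
    (S : Set (Matrix (Fin d) (Fin d) ℂ)) : ℝ≥0∞ :=
  limUnder atTop (fun n : ℕ => setNorm N (S ^ n) ^ (1 / (n : ℝ)))

/-- Boundedness of a set of matrices (in any norm, equivalently entrywise). -/
def IsBoundedMatrixSet {d : ℕ} (S : Set (Matrix (Fin d) (Fin d) ℂ)) : Prop :=
  ∃ C : ℝ, ∀ A ∈ S, ∀ i j, ‖A i j‖ ≤ C

end

/-! Let `r` exceed the limsup of `ρ(Σ^n)^{1/n}`. Long products `x` of length `n` then have `|tr x| ≤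
d r^n`. In the algebra `B` generated by `Σ`, which products span, the class of `x` modulo the
radical `J` of the trace form is determined by the numbers `tr (b_i x)`, for finitely many products
`b_i`. Hence `x` is `O(r^n)` up to an element of `J` (`exists_sub_mem_traceFormRadical`). Elements
of `J` are nilpotent, so `J` is a nilpotent ideal, and only boundedly many factors from `J` survive
in a product of blocks (`Ideal.exists_norm_le_of_pow_eq_bot`). So norms grow no faster than `r'^n`
for every `r' > r`. Conversely, `ρ(Σ^k)^{1/k} ≤ ‖Σ^n‖^{1/n}` for all `k, n ≥ 1`. The limsup of the
spectral radii is thus squeezed between the liminf and the limsup of the norms, which gives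
existence of the limit together with its value. -/

/-! ### Nilpotency from traces, and nil ideals -/

/-- A square matrix over a field of characteristic zero all of whose positive powers have trace
zero is nilpotent. -/
theorem Matrix.isNilpotent_of_trace_pow_eq_zero {K ι : Type*} [Field K] [CharZero K] [Fintype ι]
    [DecidableEq ι] (x : Matrix ι ι K) (h : ∀ k : ℕ, (x ^ (k + 1)).trace = 0) :
    IsNilpotent x := by
  open Polynomial in
  have hp : x.charpoly ≠ 0 := x.charpoly_monic.ne_zero
  obtain ⟨q, hq, hdvd⟩ := x.charpoly.exists_eq_pow_rootMultiplicity_mul_and_not_dvd hp 0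
  set m := x.charpoly.rootMultiplicity 0
  rw [C_0, sub_zero] at hq hdvd
  -- The exponent is `m + 1` rather than `m` so that multiples of it have no constant term, even if
  -- `m = 0`: the trace of `x ^ 0` is not assumed to vanish.
  have hcop : IsCoprime (X ^ (m + 1) : K[X]) q :=
    ((Polynomial.irreducible_X.coprime_iff_not_dvd).2 hdvd).pow_left
  obtain ⟨a, b, hab⟩ := hcop
  have htr : ∀ a : K[X], (aeval x (a * X ^ (m + 1))).trace = 0 := by
    intro a
    induction a using Polynomial.induction_on' with
    | add p q hp hq => rw [add_mul, map_add, Matrix.trace_add, hp, hq, add_zero]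
    | monomial n c =>
      have := h (n + m)
      simp only [map_mul, aeval_monomial, map_pow, aeval_X, mul_assoc, ← pow_add]
      rw [← add_assoc, ← Algebra.smul_def, Matrix.trace_smul, this, smul_zero]
  have hzero : aeval x (X ^ m * q) = 0 := by rw [← hq]; exact Matrix.aeval_self_charpoly x
  -- This is the projection onto the part where `x` is invertible. In characteristic zero its trace
  -- is its rank.
  have hidem : IsIdempotentElem (aeval x (a * X ^ (m + 1))) := by
    rw [IsIdempotentElem, ← map_mul, ← sub_eq_zero, ← map_sub]
    have : a * X ^ (m + 1) * (a * X ^ (m + 1)) - a * X ^ (m + 1)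
        = -(a * X * b) * (X ^ m * q) := by
      linear_combination a * X ^ (m + 1) * hab
    rw [this, map_mul, hzero, mul_zero]
  have hP : aeval x (a * X ^ (m + 1)) = 0 := by
    have h1 : IsIdempotentElem (Matrix.toLin' (aeval x (a * X ^ (m + 1)))) := by
      rw [IsIdempotentElem, Module.End.mul_eq_comp, ← Matrix.toLin'_mul, hidem.eq]
    have h2 := LinearMap.IsIdempotentElem.eq_zero_of_trace_eq_zero h1
      (by rw [Matrix.trace_toLin'_eq, htr])
    exact Matrix.toLin'.map_eq_zero_iff.1 h2
  refine ⟨m, ?_⟩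
  have : (X ^ m : K[X]) = X ^ m * (a * X ^ (m + 1)) + b * (X ^ m * q) := by
    linear_combination -(X ^ m) * hab
  have h3 := congrArg (aeval x) this
  rw [map_add, map_mul, hP, map_mul, hzero] at h3
  simpa using h3

/-- A nil left ideal lies in the Jacobson radical, which is nilpotent in an Artinian ring. -/
theorem Ideal.isNilpotent_of_forall_isNilpotent {R : Type*} [Ring R] [IsArtinianRing R]
    (J : Ideal R) (h : ∀ x ∈ J, IsNilpotent x) : IsNilpotent J := by
  have hle : J ≤ Ideal.jacobson ⊥ := by
    intro x hx
    rw [Ideal.mem_jacobson_iff]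
    intro y
    obtain ⟨u, hu⟩ := (h _ (J.mul_mem_left y hx)).isUnit_one_add
    refine ⟨↑u⁻¹, ?_⟩
    have : (↑u⁻¹ : R) * y * x + ↑u⁻¹ - 1 = ↑u⁻¹ * (1 + y * x) - 1 := by noncomm_ring
    rw [this, ← hu]
    simp
  obtain ⟨n, hn⟩ := IsArtinianRing.isNilpotent_jacobson_bot (R := R)
  refine ⟨n, ?_⟩
  rw [Ideal.zero_eq_bot, eq_bot_iff] at *
  exact (Ideal.pow_right_mono hle n).trans hn

/-! ### Growth of products in a finite-dimensional algebra -/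

/-- If the elements of `T` are bounded by `α` up to bounded elements of a nilpotent ideal, then
products of elements of `T` grow at most like the powers of `2 α`. -/
theorem Ideal.exists_norm_le_of_pow_eq_bot {B : Type*} [NormedRing B] (J : Ideal B)
    [J.IsTwoSided] {k : ℕ} (hJ : J ^ k = ⊥) {T : Set B} {α β : ℝ} (hα : 0 < α) (hβ : 0 ≤ β)
    (h : ∀ x ∈ T, ∃ s, x - s ∈ J ∧ ‖s‖ ≤ α ∧ ‖x - s‖ ≤ β) :
    ∃ D : ℝ, 0 ≤ D ∧ ∀ (m : ℕ), ∀ x ∈ T ^ m, ‖x‖ ≤ D * (2 * α) ^ m := by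
  set K : ℝ := β / α with hK
  have hK0 : 0 ≤ K := by positivity
  set E : ℝ := ‖(1 : B)‖
  have hE : 0 ≤ E := norm_nonneg _
  -- For `i < k`, `y i` collects the words with exactly `i` factors from `J`. One more factor sends
  -- `y i` to `y i * s + y (i - 1) * (z - s)`. With `K = β / α` both terms obey the same bound,
  -- whence the 2.
  have key : ∀ m : ℕ, ∀ x ∈ T ^ m, ∃ y : ℕ → B, (∀ i, y i ∈ J ^ i) ∧
      (∀ i, ‖y i‖ ≤ E * K ^ i * (2 * α) ^ m) ∧ x = ∑ i ∈ Finset.range (k + 1), y i := by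
    intro m
    induction m with
    | zero =>
      intro x hx
      obtain rfl : x = 1 := by simpa using hx
      refine ⟨Pi.single 0 1, fun i => ?_, fun i => ?_, ?_⟩
      · rcases i with _ | i
        · rw [Submodule.pow_zero, Ideal.one_eq_top]
          trivial
        · simp
      · rcases i with _ | i
        · simp [E]
        · simp only [Pi.single_apply, Nat.add_eq_zero_iff, one_ne_zero, and_false, if_false,
            norm_zero]
          positivity
      · simp
    | succ m ih =>
      intro x hx
      rw [pow_succ] at hx
      obtain ⟨w, hw, z, hz, rfl⟩ := Set.mem_mul.1 hx
      obtain ⟨y, hyJ, hy, rfl⟩ := ih w hw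
      obtain ⟨s, hsJ, hs, hj⟩ := h z hz
      obtain ⟨u, hu₀, hu⟩ : ∃ u : ℕ → B, u 0 = 0 ∧ ∀ i, u (i + 1) = y i * (z - s) :=
        ⟨fun i => Nat.casesOn i 0 (fun i => y i * (z - s)), rfl, fun _ => rfl⟩
      refine ⟨fun i => y i * s + u i, fun i => add_mem (Ideal.mul_mem_right _ _ (hyJ i)) ?_,
        fun i => ?_, ?_⟩
      · rcases i with _ | i
        · rw [hu₀]
          exact zero_mem _
        · rw [hu, Submodule.pow_succ]
          exact Ideal.mul_mem_mul (hyJ i) hsJ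
      · have h1 : ‖y i * s‖ ≤ E * K ^ i * (2 * α) ^ m * α :=
          (norm_mul_le _ _).trans (mul_le_mul (hy i) hs (norm_nonneg _) (by positivity))
        have h2 : ‖u i‖ ≤ E * K ^ i * (2 * α) ^ m * α := by
          rcases i with _ | i
          · rw [hu₀, norm_zero]
            positivity
          · rw [hu]
            refine (norm_mul_le _ _).trans
              ((mul_le_mul (hy i) hj (norm_nonneg _) (by positivity)).trans (le_of_eq ?_))
            rw [pow_succ, hK]
            field_simp
        refine (norm_add_le _ _).trans ((add_le_add h1 h2).trans (le_of_eq ?_))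
        ring
      · have hyk : y k = 0 := by simpa [hJ] using hyJ k
        have h1 : ∑ i ∈ Finset.range (k + 1), y i = ∑ i ∈ Finset.range k, y i := by
          rw [Finset.sum_range_succ, hyk, add_zero]
        rw [Finset.sum_add_distrib, ← Finset.sum_mul, Finset.sum_range_succ' u, hu₀]
        simp only [hu]
        rw [← Finset.sum_mul, ← h1, add_zero, ← mul_add, add_sub_cancel]
  refine ⟨∑ i ∈ Finset.range (k + 1), E * K ^ i, by positivity, fun m x hx => ?_⟩
  obtain ⟨y, -, hy, rfl⟩ := key m x hx
  rw [Finset.sum_mul]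
  exact norm_sum_le_of_le _ fun i _ => hy i

theorem Submonoid.exists_mem_pow_of_mem_closure {M : Type*} [Monoid M] {S : Set M} {x : M}
    (hx : x ∈ Submonoid.closure S) : ∃ n : ℕ, x ∈ S ^ n := by
  induction hx using Submonoid.closure_induction with
  | mem x hx => exact ⟨1, by simpa using hx⟩
  | one => exact ⟨0, by simp⟩
  | mul x y _ _ hx hy =>
    obtain ⟨m, hm⟩ := hx
    obtain ⟨n, hn⟩ := hy
    exact ⟨m + n, by rw [pow_add]; exact Set.mul_mem_mul hm hn⟩

theorem Set.norm_le_pow_of_mem_pow {B : Type*} [NormedRing B] {S : Set B} {M : ℝ} (hM : 0 ≤ M)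
    (hS : ∀ x ∈ S, ‖x‖ ≤ M) (n : ℕ) : ∀ x ∈ S ^ n, ‖x‖ ≤ ‖(1 : B)‖ * M ^ n := by
  induction n with
  | zero => intro x hx; simp_all
  | succ n ih =>
    intro x hx
    rw [pow_succ] at hx
    obtain ⟨w, hw, z, hz, rfl⟩ := Set.mem_mul.1 hx
    rw [pow_succ, ← mul_assoc]
    exact (norm_mul_le _ _).trans (mul_le_mul (ih w hw) (hS z hz) (norm_nonneg _) (by positivity))

/-- The radical of the trace form `(x, y) ↦ τ (x * y)`, as a left ideal. -/
def traceFormRadical {B : Type*} [Ring B] [Algebra ℂ B] (τ : B →ₗ[ℂ] ℂ) : Ideal B where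
  carrier := {x | ∀ y, τ (y * x) = 0}
  add_mem' := fun ha hb y => by rw [mul_add, map_add, ha y, hb y, add_zero]
  zero_mem' := fun y => by rw [mul_zero, map_zero]
  smul_mem' := fun c x hx y => by rw [smul_eq_mul, ← mul_assoc, hx]

theorem traceFormRadical_isTwoSided {B : Type*} [Ring B] [Algebra ℂ B] {τ : B →ₗ[ℂ] ℂ}
    (hτ : ∀ x y, τ (x * y) = τ (y * x)) : (traceFormRadical τ).IsTwoSided where
  mul_mem_of_left {x} a hx y := by rw [← mul_assoc, hτ, ← mul_assoc, hx]

/-- If a trace is small on the semigroup generated by `S`, then each long product of elements of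
`S` is small up to an element of the radical of the trace form. -/
theorem exists_sub_mem_traceFormRadical {B : Type*} [NormedRing B] [NormedAlgebra ℂ B]
    [FiniteDimensional ℂ B] {τ : B →ₗ[ℂ] ℂ} {S : Set B}
    (hspan : Submodule.span ℂ (Submonoid.closure S : Set B) = ⊤) {c r : ℝ} (hc : 0 ≤ c)
    (hr : 0 < r) {n₀ : ℕ} (htr : ∀ n ≥ n₀, ∀ x ∈ S ^ n, ‖τ x‖ ≤ c * r ^ n) :
    ∃ C : ℝ, 0 < C ∧ ∀ n ≥ n₀, ∀ x ∈ S ^ n, ∃ s, x - s ∈ traceFormRadical τ ∧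
      ‖s‖ ≤ C * r ^ n := by
  obtain ⟨k, b, hbS, hb⟩ : ∃ (k : ℕ) (b : Fin k → B), (∀ i, b i ∈ Submonoid.closure S) ∧
      Submodule.span ℂ (Set.range b) = ⊤ := by
    obtain ⟨b, hbS, hb, -⟩ := Submodule.exists_fun_fin_finrank_span_eq ℂ
      (Submonoid.closure S : Set B)
    exact ⟨_, b, hbS, hb.trans hspan⟩
  choose l hl using fun i => Submonoid.exists_mem_pow_of_mem_closure (hbS i)
  let Φ : B →ₗ[ℂ] (Fin k → ℂ) := LinearMap.pi fun i => τ ∘ₗ LinearMap.mulLeft ℂ (b i)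
  have hΦ : ∀ x i, Φ x i = τ (b i * x) := fun _ _ => rfl
  have hker : ∀ x, Φ x = 0 → x ∈ traceFormRadical τ := by
    intro x hx y
    have hy : y ∈ Submodule.span ℂ (Set.range b) := by rw [hb]; trivial
    induction hy using Submodule.span_induction with
    | mem y hy =>
      obtain ⟨i, rfl⟩ := hy
      exact congrFun hx i
    | zero => simp
    | add y z _ _ hy hz => rw [add_mul, map_add, hy, hz, add_zero]
    | smul a y _ hy => rw [smul_mul_assoc, map_smul, hy, smul_zero]
  -- A linear section of `Φ` on its range picks a representative modulo the radical whose norm is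
  -- controlled by the traces `Φ x`.
  obtain ⟨g₀, hg₀⟩ := Φ.rangeRestrict.exists_rightInverse_of_surjective Φ.range_rangeRestrict
  obtain ⟨g, hg⟩ := g₀.exists_extend
  have hgΦ : ∀ x, Φ (g (Φ x)) = Φ x := by
    intro x
    have h1 : g (Φ x) = g₀ (Φ.rangeRestrict x) := by rw [← hg]; rfl
    have h2 := congrArg Subtype.val (LinearMap.congr_fun hg₀ (Φ.rangeRestrict x))
    rw [h1]
    exact h2
  set G := ‖LinearMap.toContinuousLinearMap g‖
  set R := c * ∑ i, r ^ l i
  have hR : 0 ≤ R := by positivity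
  refine ⟨G * R + 1, by positivity, fun n hn x hx => ⟨g (Φ x), hker _ ?_, ?_⟩⟩
  · rw [map_sub, hgΦ, sub_self]
  · have h1 : ‖Φ x‖ ≤ R * r ^ n := by
      refine (pi_norm_le_iff_of_nonneg (by positivity)).2 fun i => ?_
      have hmem : b i * x ∈ S ^ (l i + n) := by rw [pow_add]; exact Set.mul_mem_mul (hl i) hx
      rw [hΦ]
      refine (htr _ (by lia) _ hmem).trans ?_
      rw [pow_add, ← mul_assoc]
      exact mul_le_mul_of_nonneg_right (mul_le_mul_of_nonneg_left
        (Finset.single_le_sum (f := fun i => r ^ l i) (fun i _ => by positivity)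
          (Finset.mem_univ i)) hc) (by positivity)
    calc ‖g (Φ x)‖ = ‖LinearMap.toContinuousLinearMap g (Φ x)‖ := rfl
      _ ≤ G * ‖Φ x‖ := ContinuousLinearMap.le_opNorm _ _
      _ ≤ G * (R * r ^ n) := by gcongr
      _ ≤ (G * R + 1) * r ^ n := by nlinarith [pow_pos hr n]

/-- In a finite-dimensional algebra with a trace that detects nilpotency, the products of elements
of a bounded generating set grow at most as fast as their traces. -/
theorem exists_norm_le_of_trace_le {B : Type*} [NormedRing B] [NormedAlgebra ℂ B]
    [FiniteDimensional ℂ B] {τ : B →ₗ[ℂ] ℂ} (hτ : ∀ x y, τ (x * y) = τ (y * x))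
    (hnil : ∀ x, (∀ y, τ (y * x) = 0) → IsNilpotent x) {S : Set B}
    (hspan : Submodule.span ℂ (Submonoid.closure S : Set B) = ⊤) {M : ℝ}
    (hS : ∀ x ∈ S, ‖x‖ ≤ M) {c r r' : ℝ} (hc : 0 ≤ c) (hr : 0 < r) (hrr' : r < r') {n₀ : ℕ}
    (htr : ∀ n ≥ n₀, ∀ x ∈ S ^ n, ‖τ x‖ ≤ c * r ^ n) :
    ∃ D : ℝ, 0 ≤ D ∧ ∀ n : ℕ, ∀ x ∈ S ^ n, ‖x‖ ≤ D * r' ^ n := by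
  wlog hM : 0 ≤ M generalizing M
  · exact this (M := |M|) (fun x hx => (hS x hx).trans (le_abs_self M)) (abs_nonneg M)
  have hr' : 0 < r' := hr.trans hrr'
  obtain ⟨C, hC, hdec⟩ := exists_sub_mem_traceFormRadical hspan hc hr htr
  have : IsArtinianRing B := IsArtinianRing.of_finite ℂ B
  have := traceFormRadical_isTwoSided hτ
  obtain ⟨k, hk⟩ := Ideal.isNilpotent_of_forall_isNilpotent (traceFormRadical τ) hnil
  -- The gap between `r` and `r'` absorbs the constant `2 * C` once the block length `n` is large.
  obtain ⟨n, hn₀, hn, hCn⟩ : ∃ n, n₀ ≤ n ∧ 0 < n ∧ 2 * (C * r ^ n) ≤ r' ^ n := by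
    have h1 : Tendsto (fun n : ℕ => 2 * C * (r / r') ^ n) atTop (𝓝 (2 * C * 0)) :=
      (tendsto_pow_atTop_nhds_zero_of_lt_one (by positivity)
        ((div_lt_one hr').2 hrr')).const_mul _
    rw [mul_zero] at h1
    obtain ⟨n, ⟨h2, h3⟩, h4⟩ := (((eventually_ge_atTop n₀).and (eventually_gt_atTop 0)).and
      (h1.eventually_le_const zero_lt_one)).exists
    refine ⟨n, h2, h3, ?_⟩
    rw [div_pow, mul_div_assoc', div_le_one (by positivity)] at h4
    linarith
  obtain ⟨D, hD, hDm⟩ := Ideal.exists_norm_le_of_pow_eq_bot (traceFormRadical τ) (T := S ^ n) hk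
    (α := C * r ^ n) (β := ‖(1 : B)‖ * M ^ n + C * r ^ n) (by positivity) (by positivity)
    (fun x hx => by
      obtain ⟨s, hs, hs'⟩ := hdec n hn₀ x hx
      exact ⟨s, hs, hs', (norm_sub_le _ _).trans
        (add_le_add (Set.norm_le_pow_of_mem_pow hM hS n x hx) hs')⟩)
  -- `Q` bounds the contribution of the incomplete last block, of length `N % n < n`.
  set Q : ℝ := (1 + M / r') ^ n
  refine ⟨D * (‖(1 : B)‖ * Q), by positivity, fun N x hx => ?_⟩
  rw [← Nat.div_add_mod N n, pow_add, pow_mul] at hx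
  obtain ⟨w, hw, z, hz, rfl⟩ := Set.mem_mul.1 hx
  have h1 : ‖w‖ ≤ D * (r' ^ n) ^ (N / n) := (hDm _ w hw).trans (by gcongr)
  have h2 : ‖z‖ ≤ ‖(1 : B)‖ * Q * r' ^ (N % n) := by
    refine (Set.norm_le_pow_of_mem_pow hM hS _ z hz).trans ?_
    have h3 : (M / r') ^ (N % n) ≤ Q := by
      have h0 : 0 ≤ M / r' := by positivity
      calc (M / r') ^ (N % n) ≤ (1 + M / r') ^ (N % n) := by gcongr; linarith
        _ ≤ Q := pow_le_pow_right₀ (by linarith) (Nat.mod_lt N hn).le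
    rw [div_pow, div_le_iff₀ (by positivity)] at h3
    rw [mul_assoc]
    gcongr
  refine (norm_mul_le _ _).trans ((mul_le_mul h1 h2 (norm_nonneg _) (by positivity)).trans
    (le_of_eq ?_))
  conv_rhs => rw [← Nat.div_add_mod N n, pow_add, pow_mul]
  ring

/-! ### Matrices: spectral bounds and comparison of norms -/

section

attribute [local instance] Matrix.linftyOpNormedRing Matrix.linftyOpNormedAlgebra

theorem Matrix.norm_trace_le_of_spectrum {d : ℕ} (A : Matrix (Fin d) (Fin d) ℂ) {ρ : ℝ}
    (h : ∀ z ∈ spectrum ℂ A, ‖z‖ ≤ ρ) : ‖A.trace‖ ≤ d * ρ := by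
  rw [Matrix.trace_eq_sum_roots_charpoly]
  have hroot : ∀ z ∈ A.charpoly.roots, ‖z‖ ≤ ρ := fun z hz =>
    h z (Matrix.mem_spectrum_iff_isRoot_charpoly.2 (Polynomial.isRoot_of_mem_roots hz))
  have hcard : A.charpoly.roots.card = d := by
    rw [IsAlgClosed.card_roots_eq_natDegree, Matrix.charpoly_natDegree_eq_dim, Fintype.card_fin]
  refine (norm_multiset_sum_le _).trans ?_
  refine (Multiset.sum_le_card_nsmul _ ρ ?_).trans (le_of_eq ?_)
  · intro y hy
    obtain ⟨z, hz, rfl⟩ := Multiset.mem_map.1 hy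
    exact hroot z hz
  · rw [Multiset.card_map, hcard, nsmul_eq_mul]

/-- The products of matrices of a bounded set grow at most as fast as their spectral radii. -/
theorem Matrix.exists_norm_le_of_spectrum_le {d : ℕ} {S : Set (Matrix (Fin d) (Fin d) ℂ)} {M : ℝ}
    (hS : ∀ A ∈ S, ‖A‖ ≤ M) {r r' : ℝ} (hr : 0 < r) (hrr' : r < r') {n₀ : ℕ}
    (h : ∀ n ≥ n₀, ∀ A ∈ S ^ n, ∀ z ∈ spectrum ℂ A, ‖z‖ ≤ r ^ n) :
    ∃ D : ℝ, 0 ≤ D ∧ ∀ n : ℕ, ∀ A ∈ S ^ n, ‖A‖ ≤ D * r' ^ n := by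
  -- The trace form on all matrices has zero radical, but there `S` need not generate; only traces
  -- of products of elements of `S` are controlled.
  let B := Algebra.adjoin ℂ S
  let S' : Set B := Subtype.val ⁻¹' S
  have himage : ∀ n, B.val '' (S' ^ n) = S ^ n := by
    intro n
    rw [Set.image_pow]
    congr 1
    exact Subtype.image_preimage_coe _ _ |>.trans
      (Set.inter_eq_right.2 (Algebra.subset_adjoin))
  let τ : B →ₗ[ℂ] ℂ := Matrix.traceLinearMap (Fin d) ℂ ℂ ∘ₗ B.val.toLinearMap
  have hτ : ∀ x : B, τ x = (x : Matrix (Fin d) (Fin d) ℂ).trace := fun _ => rfl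
  have hnil : ∀ x : B, (∀ y, τ (y * x) = 0) → IsNilpotent x := by
    intro x hx
    obtain ⟨k, hk⟩ := Matrix.isNilpotent_of_trace_pow_eq_zero (x : Matrix (Fin d) (Fin d) ℂ)
      fun k => by simpa [hτ, pow_succ] using hx (x ^ k)
    exact ⟨k, Subtype.ext (by simpa using hk)⟩
  have hspan : Submodule.span ℂ (Submonoid.closure S' : Set B) = ⊤ := by
    rw [← Algebra.adjoin_eq_span, Algebra.adjoin_adjoin_coe_preimage, Algebra.top_toSubmodule]
  obtain ⟨D, hD, hDn⟩ := exists_norm_le_of_trace_le (τ := τ) (S := S') (M := M) (c := d)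
    (n₀ := n₀) (fun x y => by simpa [hτ] using Matrix.trace_mul_comm _ _) hnil hspan
    (fun x hx => hS _ hx) (Nat.cast_nonneg d) hr hrr' (fun n hn x hx =>
      Matrix.norm_trace_le_of_spectrum _
        (h n hn _ (by rw [← himage]; exact Set.mem_image_of_mem _ hx)))
  refine ⟨D, hD, fun n A hA => ?_⟩
  rw [← himage] at hA
  obtain ⟨x, hx, rfl⟩ := hA
  exact hDn n x hx

theorem IsBoundedMatrixSet.exists_norm_le {d : ℕ} {S : Set (Matrix (Fin d) (Fin d) ℂ)}
    (hS : IsBoundedMatrixSet S) : ∃ M : ℝ, ∀ A ∈ S, ‖A‖ ≤ M := by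
  obtain ⟨C, hC⟩ := hS
  refine ⟨d * |C|, fun A hA => ?_⟩
  have h : ‖A‖₊ ≤ d * ‖C‖₊ := by
    rw [Matrix.linfty_opNNNorm_def]
    refine Finset.sup_le fun i _ => ?_
    refine (Finset.sum_le_card_nsmul _ _ ‖C‖₊ fun j _ => ?_).trans (by simp)
    exact (hC A hA i j).trans (le_abs_self C)
  exact_mod_cast h

/-- Transfers the growth bound from the auxiliary submultiplicative norm to `N`. On the unit sphere,
which is compact, the continuous function `N` is bounded above and away from zero. -/
theorem exists_matrixOpNorm_le {d : ℕ} {N : Seminorm ℂ (Fin d → ℂ)}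
    (hN : ∀ v : Fin d → ℂ, N v = 0 → v = 0) :
    ∃ c : ℝ, 0 ≤ c ∧ ∀ A, matrixOpNorm N A ≤ ENNReal.ofReal (c * ‖A‖) := by
  have hcont : Continuous N := continuousOn_univ.1 (N.convexOn.continuousOn isOpen_univ)
  have hscale : ∀ v : Fin d → ℂ, v ≠ 0 → ∃ u ∈ Metric.sphere (0 : Fin d → ℂ) 1,
      N v = ‖v‖ * N u := by
    intro v hv
    have hv' : ‖v‖ ≠ 0 := norm_ne_zero_iff.2 hv
    refine ⟨((‖v‖⁻¹ : ℝ) : ℂ) • v, by simp [norm_smul, hv'], ?_⟩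
    rw [map_smul_eq_mul]
    simp [hv']
  obtain ⟨a, ha, hle⟩ : ∃ a, 0 < a ∧ ∀ u ∈ Metric.sphere (0 : Fin d → ℂ) 1, a ≤ N u :=
    (isCompact_sphere _ _).exists_forall_le' hcont.continuousOn fun u hu =>
      (apply_nonneg N u).lt_of_ne' fun h => by simp [hN u h] at hu
  obtain ⟨b, hb⟩ := (isCompact_sphere (0 : Fin d → ℂ) 1).exists_bound_of_continuousOn
    hcont.continuousOn
  have hlower : ∀ v, ‖v‖ ≤ a⁻¹ * N v := by
    intro v
    rcases eq_or_ne v 0 with rfl | hv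
    · simp
    · obtain ⟨u, hu, h⟩ := hscale v hv
      rw [h, le_inv_mul_iff₀ ha, mul_comm]
      exact mul_le_mul_of_nonneg_left (hle u hu) (norm_nonneg v)
  have hupper : ∀ v, N v ≤ |b| * ‖v‖ := by
    intro v
    rcases eq_or_ne v 0 with rfl | hv
    · simp
    · obtain ⟨u, hu, h⟩ := hscale v hv
      rw [h, mul_comm]
      exact mul_le_mul_of_nonneg_right
        (((le_abs_self _).trans (hb u hu)).trans (le_abs_self b)) (norm_nonneg v)
  refine ⟨|b| * a⁻¹, by positivity, fun A => iSup₂_le fun v hv => ENNReal.ofReal_le_ofReal ?_⟩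
  have h1 : ‖v‖ ≤ a⁻¹ := by simpa [hv] using hlower v
  calc N (A *ᵥ v) ≤ |b| * ‖A *ᵥ v‖ := hupper _
    _ ≤ |b| * (‖A‖ * a⁻¹) := by
      gcongr
      exact (Matrix.linfty_opNorm_mulVec A v).trans (by gcongr)
    _ = |b| * a⁻¹ * ‖A‖ := by ring

theorem ofReal_apply_mulVec_le {d : ℕ} {N : Seminorm ℂ (Fin d → ℂ)}
    (hN : ∀ v : Fin d → ℂ, N v = 0 → v = 0) (A : Matrix (Fin d) (Fin d) ℂ) (v : Fin d → ℂ) :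
    ENNReal.ofReal (N (A *ᵥ v)) ≤ matrixOpNorm N A * ENNReal.ofReal (N v) := by
  rcases eq_or_ne (N v) 0 with h | h
  · simp [hN v h]
  have h1 : N (((N v)⁻¹ : ℂ) • v) = 1 := by
    rw [map_smul_eq_mul]
    simp [abs_of_nonneg (apply_nonneg N v), h]
  have h2 : A *ᵥ v = (N v : ℂ) • (A *ᵥ (((N v)⁻¹ : ℂ) • v)) := by
    rw [Matrix.mulVec_smul, smul_smul, mul_inv_cancel₀ (by exact_mod_cast h), one_smul]
  rw [h2, map_smul_eq_mul, mul_comm]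
  rw [Complex.norm_real, Real.norm_of_nonneg (apply_nonneg N v),
    ENNReal.ofReal_mul (apply_nonneg N _)]
  gcongr
  exact le_iSup₂ (f := fun (v : Fin d → ℂ) (_ : N v = 1) => ENNReal.ofReal (N (A *ᵥ v))) _ h1

theorem matrixOpNorm_mul_le {d : ℕ} {N : Seminorm ℂ (Fin d → ℂ)}
    (hN : ∀ v : Fin d → ℂ, N v = 0 → v = 0) (A B : Matrix (Fin d) (Fin d) ℂ) :
    matrixOpNorm N (A * B) ≤ matrixOpNorm N A * matrixOpNorm N B := by
  refine iSup₂_le fun v hv => ?_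
  rw [← Matrix.mulVec_mulVec]
  refine (ofReal_apply_mulVec_le hN A _).trans ?_
  gcongr
  exact le_iSup₂ (f := fun (v : Fin d → ℂ) (_ : N v = 1) => ENNReal.ofReal (N (B *ᵥ v))) v hv

theorem setNorm_pow_le {d : ℕ} {N : Seminorm ℂ (Fin d → ℂ)}
    (hN : ∀ v : Fin d → ℂ, N v = 0 → v = 0) (S : Set (Matrix (Fin d) (Fin d) ℂ)) (n : ℕ) :
    setNorm N (S ^ n) ≤ setNorm N S ^ n := by
  induction n with
  | zero =>
    refine iSup₂_le fun A hA => iSup₂_le fun v hv => ?_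
    obtain rfl : A = 1 := by simpa using hA
    simp [hv]
  | succ n ih =>
    refine iSup₂_le fun A hA => ?_
    rw [pow_succ] at hA
    obtain ⟨B, hB, C, hC, rfl⟩ := Set.mem_mul.1 hA
    rw [pow_succ]
    refine (matrixOpNorm_mul_le hN B C).trans (mul_le_mul' ((le_iSup₂ (f := fun A
      (_ : A ∈ S ^ n) => matrixOpNorm N A) B hB).trans ih) ?_)
    exact le_iSup₂ (f := fun A (_ : A ∈ S) => matrixOpNorm N A) C hC

theorem spectralRadius_le_matrixOpNorm {d : ℕ} {N : Seminorm ℂ (Fin d → ℂ)}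
    (hN : ∀ v : Fin d → ℂ, N v = 0 → v = 0) (A : Matrix (Fin d) (Fin d) ℂ) :
    spectralRadius ℂ A ≤ matrixOpNorm N A := by
  refine iSup₂_le fun z hz => ?_
  rw [← Matrix.spectrum_toLin'] at hz
  obtain ⟨v, hv⟩ := (Module.End.hasEigenvalue_iff_mem_spectrum.2 hz).exists_hasEigenvector
  have h1 : A *ᵥ v = z • v := by simpa using hv.apply_eq_smul
  have h2 := ofReal_apply_mulVec_le hN A v
  have h3 : 0 < N v := (apply_nonneg N v).lt_of_ne' fun h => hv.2 (hN v h)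
  rw [h1, map_smul_eq_mul, ENNReal.ofReal_mul (norm_nonneg z)] at h2
  have h4 := (ENNReal.mul_le_mul_iff_left (by simpa using h3) ENNReal.ofReal_ne_top).1 h2
  rwa [ofReal_norm] at h4

/-- For `A ∈ S ^ k`, the power `A ^ n` lies in `(S ^ n) ^ k`. As `k` and `n` are independent, this
compares a limsup with a liminf. -/
theorem setSpectralRadius_rpow_le_setNorm_rpow {d : ℕ} {N : Seminorm ℂ (Fin d → ℂ)}
    (hN : ∀ v : Fin d → ℂ, N v = 0 → v = 0) (S : Set (Matrix (Fin d) (Fin d) ℂ)) {k n : ℕ}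
    (hk : 0 < k) (hn : 0 < n) :
    setSpectralRadius (S ^ k) ^ (1 / (k : ℝ)) ≤ setNorm N (S ^ n) ^ (1 / (n : ℝ)) := by
  have hk' : (0 : ℝ) < k := Nat.cast_pos.2 hk
  have hn' : (0 : ℝ) < n := Nat.cast_pos.2 hn
  rw [one_div, ENNReal.rpow_inv_le_iff hk', ← ENNReal.rpow_mul, one_div_mul_eq_div]
  refine iSup₂_le fun A hA => ?_
  have h1 : spectralRadius ℂ A ^ n ≤ setNorm N (S ^ n) ^ k := by
    refine (spectrum.spectralRadius_pow_le A n hn.ne').trans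
      ((spectralRadius_le_matrixOpNorm hN _).trans ?_)
    refine le_trans ?_ (setNorm_pow_le hN (S ^ n) k)
    refine le_iSup₂ (f := fun A (_ : A ∈ (S ^ n) ^ k) => matrixOpNorm N A) (A ^ n) ?_
    rw [← pow_mul, mul_comm, pow_mul]
    exact Set.pow_mem_pow hA
  rw [div_eq_mul_inv, ENNReal.rpow_mul, ENNReal.le_rpow_inv_iff hn', ENNReal.rpow_natCast,
    ENNReal.rpow_natCast]
  exact h1

/-- The upper growth rate of the norms of products is at most that of their spectral radii. -/
theorem limsup_setNorm_le {d : ℕ} {N : Seminorm ℂ (Fin d → ℂ)}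
    (hN : ∀ v : Fin d → ℂ, N v = 0 → v = 0) {S : Set (Matrix (Fin d) (Fin d) ℂ)}
    (hS : IsBoundedMatrixSet S) :
    limsup (fun n : ℕ => setNorm N (S ^ n) ^ (1 / (n : ℝ))) atTop ≤
      limsup (fun n : ℕ => setSpectralRadius (S ^ n) ^ (1 / (n : ℝ))) atTop := by
  refine le_of_forall_gt_imp_ge_of_dense fun b hb => ?_
  obtain ⟨r', hr', hr'b⟩ := ENNReal.lt_iff_exists_nnreal_btwn.1 hb
  obtain ⟨r, hr, hrr'⟩ := ENNReal.lt_iff_exists_nnreal_btwn.1 hr'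
  have hr0 : 0 < r := ENNReal.coe_pos.1 (pos_of_gt hr)
  obtain ⟨M, hM⟩ := hS.exists_norm_le
  obtain ⟨n₀, hn₀⟩ := eventually_atTop.1 (eventually_lt_of_limsup_lt hr)
  -- The shift to `n₀ + 1` excludes `n = 0`, where the exponent `1 / n` is the default value 0.
  obtain ⟨D, hD, hDn⟩ := Matrix.exists_norm_le_of_spectrum_le hM (r := r) (r' := r')
    (n₀ := n₀ + 1) (by exact_mod_cast hr0) (by exact_mod_cast hrr') (by
      intro n hn A hA z hz
      have hn' : (0 : ℝ) < n := by exact_mod_cast (Nat.succ_pos _).trans_le hn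
      have h1 := (hn₀ n (by lia)).le
      rw [one_div, ENNReal.rpow_inv_le_iff hn', ENNReal.rpow_natCast] at h1
      have h2 : (‖z‖₊ : ℝ≥0∞) ≤ (r : ℝ≥0∞) ^ n :=
        (le_iSup₂ (f := fun z (_ : z ∈ spectrum ℂ A) => (‖z‖₊ : ℝ≥0∞)) z hz).trans
          ((le_iSup₂ (f := fun A (_ : A ∈ S ^ n) => spectralRadius ℂ A) A hA).trans h1)
      exact_mod_cast h2)
  obtain ⟨c, hc, hcA⟩ := exists_matrixOpNorm_le hN
  -- The added 1 makes `K` positive, so that `K ^ (1 / n)` tends to 1.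
  set K : ℝ := c * D + 1
  have hK : 0 < K := by positivity
  have hle : ∀ᶠ n : ℕ in atTop, setNorm N (S ^ n) ^ (1 / (n : ℝ)) ≤
      ENNReal.ofReal (K ^ (1 / (n : ℝ)) * r') := by
    filter_upwards [eventually_gt_atTop 0] with n hn
    have hn' : (0 : ℝ) < n := Nat.cast_pos.2 hn
    rw [one_div, ENNReal.rpow_inv_le_iff hn', ENNReal.rpow_natCast, ← ENNReal.ofReal_pow
      (by positivity), mul_pow, ← Real.rpow_natCast (K ^ _), ← Real.rpow_mul hK.le,
      inv_mul_cancel₀ hn'.ne', Real.rpow_one]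
    refine iSup₂_le fun A hA => (hcA A).trans (ENNReal.ofReal_le_ofReal ?_)
    calc c * ‖A‖ ≤ c * (D * r' ^ n) := by gcongr; exact hDn n A hA
      _ ≤ K * r' ^ n := by
        have : (0 : ℝ) ≤ r' ^ n := by positivity
        simp only [K]
        nlinarith
  have hlim : Tendsto (fun n : ℕ => ENNReal.ofReal (K ^ (1 / (n : ℝ)) * r')) atTop
      (𝓝 (r' : ℝ≥0∞)) := by
    have h1 : Tendsto (fun n : ℕ => K ^ (1 / (n : ℝ)) * (r' : ℝ)) atTop
        (𝓝 (K ^ (0 : ℝ) * r')) :=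
      (((Real.continuous_const_rpow hK.ne').tendsto 0).comp
        tendsto_one_div_atTop_nhds_zero_nat).mul_const _
    rw [Real.rpow_zero, one_mul] at h1
    simpa using ENNReal.tendsto_ofReal h1
  calc _ ≤ limsup (fun n : ℕ => ENNReal.ofReal (K ^ (1 / (n : ℝ)) * r')) atTop :=
        limsup_le_limsup hle
    _ = r' := hlim.limsup_eq
    _ ≤ b := hr'b.le

theorem setNorm_lt_top {d : ℕ} {N : Seminorm ℂ (Fin d → ℂ)}
    (hN : ∀ v : Fin d → ℂ, N v = 0 → v = 0) {S : Set (Matrix (Fin d) (Fin d) ℂ)}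
    (hS : IsBoundedMatrixSet S) : setNorm N S < ⊤ := by
  obtain ⟨M, hM⟩ := hS.exists_norm_le
  obtain ⟨c, hc, hcA⟩ := exists_matrixOpNorm_le hN
  refine lt_of_le_of_lt (iSup₂_le fun A hA => (hcA A).trans (ENNReal.ofReal_le_ofReal ?_))
    (ENNReal.ofReal_lt_top (r := c * M))
  gcongr
  exact hM A hA

end

/-! ### The Berger–Wang theorem -/

theorem mainTheorem3 (d : ℕ) (hd : 1 ≤ d)
    (N : Seminorm ℂ (Fin d → ℂ)) (hN : ∀ v : Fin d → ℂ, N v = 0 → v = 0)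
    (S : Set (Matrix (Fin d) (Fin d) ℂ)) (hne : S.Nonempty) (hS : IsBoundedMatrixSet S) :
    Tendsto (fun n : ℕ => setNorm N (S ^ n) ^ (1 / (n : ℝ))) atTop
        (𝓝 (jointSpectralRadius N S)) ∧
      jointSpectralRadius N S < ⊤ ∧
      jointSpectralRadius N S =
        limsup (fun n : ℕ => setSpectralRadius (S ^ n) ^ (1 / (n : ℝ))) atTop := by
  have hlim : Tendsto (fun n : ℕ => setNorm N (S ^ n) ^ (1 / (n : ℝ))) atTop
      (𝓝 (limsup (fun n : ℕ => setSpectralRadius (S ^ n) ^ (1 / (n : ℝ))) atTop)) := by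
    refine tendsto_of_le_liminf_of_limsup_le ?_ (limsup_setNorm_le hN hS)
    refine le_liminf_of_le (h := ?_)
    filter_upwards [eventually_gt_atTop 0] with n hn
    refine limsup_le_of_le (h := ?_)
    filter_upwards [eventually_gt_atTop 0] with k hk
    exact setSpectralRadius_rpow_le_setNorm_rpow hN S hk hn
  have heq := hlim.limUnder_eq
  rw [← jointSpectralRadius] at heq
  refine ⟨heq ▸ hlim, ?_, heq⟩
  refine lt_of_le_of_lt ?_ (setNorm_lt_top hN hS)
  rw [heq]
  refine le_of_tendsto hlim ?_
  filter_upwards [eventually_gt_atTop 0] with n hn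
  rw [one_div, ENNReal.rpow_inv_le_iff (Nat.cast_pos.2 hn), ENNReal.rpow_natCast]
  exact setNorm_pow_le hN S n
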